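/- Let $F\in\mathbb{C}[x,y]$ be an irreducible polynomial of positive degree in $y$, so that $F(w,w')=0$ is an irreducible first order algebraic differential equation with constant coefficients, where $w'=dw/dz$. A *rational general solution* of $F(w,w')=0$ is a rational function $w=w(z,\lambda)\in\mathbb{C}(z,\lambda)$ in which the arbitrary constant $\lambda$ really occurs ($w\notin\mathbb{C}(z)$) and such that $F(w,\partial w/\partial z)=0$; it is *non-constant* if it is not constant in $z$, i.e. $w\notin\mathbb{C}(\lambda)$. A *rational parametrization* of the curve $F(x,y)=0$ is a pair $\varphi,\psi\in\mathbb{C}(t)$ such that $(\varphi(t_0),\psi(t_0))$ is a point of the curve for all but finitely many $t_0\in\mathbb{C}$, and all but finitely many points of the curve are of the form $(\varphi(t_0),\psi(t_0))$ for exactly one $t_0\in\mathbb{C}$. Substituting $w=\varphi(t)$, $w'=\psi(t)$ turns $F(w,w')=0$ into the equation $t'=R(t)$ with $R=\psi/\frac{d\varphi}{dt}$. We say that $F(w,w')=0$ *is reduced along* $(\varphi,\psi)$ to $u'=S(u)$ if $t'=R(t)$ becomes $u'=S(u)$ under some change of variable $t=\alpha u+\beta$ with $\alpha,\beta\in\mathbb{C}$,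 $\alpha\neq0$. Then: 1. $F(w,w')=0$ has a non-constant rational general solution if and only if there is a rational parametrization of $F(x,y)=0$ along which the equation is reduced either to a linear equation $u'=c$ for some constant $c\in\mathbb{C}$, $c\neq 0$, or to the Riccati equation $u'+u^2=0$. 2. Moreover the choice of the parametrization does not matter: for every rational parametrization $(\varphi,\psi)$ of $F(x,y)=0$, the equation $F(w,w')=0$ has a non-constant rational general solution if and only if it is reduced along $(\varphi,\psi)$ either to $u'=c$ for some constant $c\neq0$ or to $u'+u^2=0$. 3. The Riccati equation $u'+u^2=0$ has the rational general solution $u=\dfrac{1}{z+\lambda}$. -/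

import Mathlib

noncomputable section

namespace FirstOrderADE

/-- The derivative of a rational function with respect to its (outer) variable,
by the quotient rule. -/
def ratDeriv {K : Type*} [Field K] (f : RatFunc K) : RatFunc K :=
  algebraMap (Polynomial K) (RatFunc K)
      (Polynomial.derivative f.num * f.denom - f.num * Polynomial.derivative f.denom) /
    algebraMap (Polynomial K) (RatFunc K) (f.denom ^ 2)

/-- The field `ℂ(z, λ)`, presented as `ℂ(λ)(z)`: the outer variable is `z`, the inner one is the
parameter `λ`. Hence `ratDeriv` on this field is `∂/∂z`. -/
abbrev RatZL : Type := RatFunc (RatFunc ℂ)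

/-- The variable `z` of `ℂ(z, λ)`. -/
def zVar : RatZL := RatFunc.X

/-- The parameter `λ` of `ℂ(z, λ)`. -/
def lamVar : RatZL := RatFunc.C RatFunc.X

/-- A rational function `v(z)` of one variable, regarded as an element of `ℂ(z, λ)` in which
`λ` does not occur. -/
def ofZ (v : RatFunc ℂ) : RatZL :=
  RatFunc.eval (RatFunc.C.comp RatFunc.C : ℂ →+* RatZL) zVar v

/-- `w(z, λ)` is a rational general solution of `F(w, w') = 0` (variable `0` of `F` stands for
`w`, variable `1` for `w'`): it is rational in `z` and `λ`, it solves the equation identically,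
and the arbitrary constant `λ` really occurs in it. -/
structure IsRationalGeneralSolution (F : MvPolynomial (Fin 2) ℂ) (w : RatZL) : Prop where
  solves : MvPolynomial.aeval ![w, ratDeriv w] F = 0
  depends : ∀ v : RatFunc ℂ, w ≠ ofZ v

/-- `w(z, λ)` is constant as a function of `z`, that is, it belongs to `ℂ(λ)`. -/
def IsConstantInZ (w : RatZL) : Prop :=
  ∃ a : RatFunc ℂ, w = RatFunc.C a

/-- `F(w, w') = 0` has a rational general solution that is not constant in `z`. -/
def HasNonconstantRationalGeneralSolution (F : MvPolynomial (Fin 2) ℂ) : Prop :=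
  ∃ w : RatZL, IsRationalGeneralSolution F w ∧ ¬ IsConstantInZ w

/-- The value of a rational function at a point (used only where it is defined). -/
def value (f : RatFunc ℂ) (t : ℂ) : ℂ := RatFunc.eval (RingHom.id ℂ) t f

/-- The rational function has no pole at `t`. -/
def DefinedAt (f : RatFunc ℂ) (t : ℂ) : Prop := f.denom.eval t ≠ 0

/-- `(φ, ψ)` is a rational parametrization of the plane curve `F(x, y) = 0`: all but finitely
many parameter values give a point of the curve, and all but finitely many points of the curve
come from exactly one parameter value. -/
structure IsRationalParametrization (F : MvPolynomial (Fin 2) ℂ) (φ ψ : RatFunc ℂ) : Prop where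
  on_curve : {t : ℂ | ¬ (DefinedAt φ t ∧ DefinedAt ψ t ∧
    MvPolynomial.eval ![value φ t, value ψ t] F = 0)}.Finite
  unique_param : {p : ℂ × ℂ | MvPolynomial.eval ![p.1, p.2] F = 0 ∧
    ¬ ∃! t : ℂ, DefinedAt φ t ∧ DefinedAt ψ t ∧ p.1 = value φ t ∧ p.2 = value ψ t}.Finite

/-- Substituting `w = φ(t)`, `w' = ψ(t)` turns `F(w, w') = 0` into the autonomous equation
`t' = R(t)` with `R = ψ / (dφ/dt)`. This is `R`. -/
def reducedRHS (φ ψ : RatFunc ℂ) : RatFunc ℂ := ψ / ratDeriv φ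

/-- Composition `f(g(u))` of rational functions, for non-constant `g`. -/
def ratComp (f g : RatFunc ℂ) : RatFunc ℂ := RatFunc.eval RatFunc.C g f

/-- A change of variable `t = α u + β`, with constants `α ≠ 0` and `β`, turns the equation
`t' = R(t)` into `u' = S(u)`. -/
def AffinelyReduces (R S : RatFunc ℂ) : Prop :=
  ∃ α β : ℂ, α ≠ 0 ∧
    ratComp R (RatFunc.C α * RatFunc.X + RatFunc.C β) / RatFunc.C α = S

/-- Along the parametrization `(φ, ψ)` and a constant affine change of variable, `F(w, w') = 0`
is reduced to `u' = c` for some constant `c ≠ 0`. -/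
def ReducesToLinear (φ ψ : RatFunc ℂ) : Prop :=
  ∃ c : ℂ, c ≠ 0 ∧ AffinelyReduces (reducedRHS φ ψ) (RatFunc.C c)

/-- Along the parametrization `(φ, ψ)` and a constant affine change of variable, `F(w, w') = 0`
is reduced to `u' + u ^ 2 = 0`. -/
def ReducesToRiccati (φ ψ : RatFunc ℂ) : Prop :=
  AffinelyReduces (reducedRHS φ ψ) (-RatFunc.X ^ 2)

end FirstOrderADE

end

/-!
A non-constant solution `w = f(z)` with `f ∈ ℂ(z)` parametrizes the curve by `(f, f')`. The field
`ℂ(f, f')` is closed under differentiation because `f''` is determined by differentiating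
`F(f, f') = 0`. As `z` is algebraic over it and `z' = 1`, differentiating its minimal polynomial
shows that `z` differs from an element of `ℂ(f, f')` by a constant, so
`ℂ(f, f') = ℂ(z)`. Hence `(f, f')` is a rational parametrization, along which the equation
becomes `t' = 1`. Any other parametrization `(φ, ψ)` equals `(f(m), f'(m))` for some rational
function `m`, and it gives the equation `t' = 1 / m'(t)`. Since a parametrization is generically
injective, so is `m`. It is therefore a Möbius transformation, and `1 / m'` is the square of a
polynomial of degree at most one divided by a constant. It becomes `c` or `-u ^ 2` under an affine
change of variable.

Conversely `c z` and `1 / z` solve `u' = c` and `u' + u ^ 2 = 0`, and substituting them into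
`φ(α u + β)` gives a solution of `F(w, w') = 0`. Translating `z` by `λ` makes it a general
solution, while specializing `λ` in a general solution gives one in `ℂ(z)`.
-/

noncomputable section

namespace FirstOrderADE

open Polynomial

/-! ### The derivation on rational functions -/

section Derivation

variable {K : Type*} [Field K]

theorem ratDeriv_div (p q : K[X]) (hq : q ≠ 0) :
    ratDeriv (algebraMap K[X] (RatFunc K) p / algebraMap K[X] (RatFunc K) q) =
      algebraMap K[X] (RatFunc K) (derivative p * q - p * derivative q) /
        algebraMap K[X] (RatFunc K) (q ^ 2) := by
  set f := algebraMap K[X] (RatFunc K) p / algebraMap K[X] (RatFunc K) q with hf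
  have hd : f.denom ≠ 0 := f.denom_ne_zero
  have hcross : f.num * q = p * f.denom := (RatFunc.num_mul_eq_mul_denom_iff hq).mpr hf
  have hcross' := congrArg derivative hcross
  simp only [derivative_mul] at hcross'
  rw [ratDeriv, div_eq_div_iff (by simpa using hd) (by simpa using hq), ← map_mul, ← map_mul]
  congr 1
  linear_combination
    (f.denom * q) * hcross' + (-derivative f.denom * q - f.denom * derivative q) * hcross

theorem ratDeriv_algebraMap (p : K[X]) :
    ratDeriv (algebraMap K[X] (RatFunc K) p) = algebraMap K[X] (RatFunc K) (derivative p) := by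
  simpa using ratDeriv_div p 1 one_ne_zero

theorem ratDeriv_C (a : K) : ratDeriv (RatFunc.C a) = 0 := by
  rw [← RatFunc.algebraMap_C, ratDeriv_algebraMap, derivative_C, map_zero]

theorem ratDeriv_X : ratDeriv (RatFunc.X : RatFunc K) = 1 := by
  rw [← RatFunc.algebraMap_X, ratDeriv_algebraMap, derivative_X, map_one]

theorem ratDeriv_add (f g : RatFunc K) : ratDeriv (f + g) = ratDeriv f + ratDeriv g := by
  induction f using RatFunc.induction_on with | _ p q hq
  induction g using RatFunc.induction_on with | _ r s hs
  have hq' : algebraMap K[X] (RatFunc K) q ≠ 0 := by simpa using hq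
  have hs' : algebraMap K[X] (RatFunc K) s ≠ 0 := by simpa using hs
  rw [div_add_div _ _ hq' hs', ← map_mul, ← map_mul, ← map_mul, ← map_add,
    ratDeriv_div _ _ (mul_ne_zero hq hs), ratDeriv_div _ _ hq, ratDeriv_div _ _ hs]
  simp only [derivative_mul, map_mul, map_add, map_sub, map_pow]
  field_simp
  ring

theorem ratDeriv_mul (f g : RatFunc K) :
    ratDeriv (f * g) = f * ratDeriv g + g * ratDeriv f := by
  induction f using RatFunc.induction_on with | _ p q hq
  induction g using RatFunc.induction_on with | _ r s hs
  have hq' : algebraMap K[X] (RatFunc K) q ≠ 0 := by simpa using hq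
  have hs' : algebraMap K[X] (RatFunc K) s ≠ 0 := by simpa using hs
  rw [div_mul_div_comm, ← map_mul, ← map_mul,
    ratDeriv_div _ _ (mul_ne_zero hq hs), ratDeriv_div _ _ hq, ratDeriv_div _ _ hs]
  simp only [derivative_mul, map_mul, map_add, map_sub, map_pow]
  field_simp
  ring

variable (K) in
/-- `ratDeriv` as a derivation of `K(X)` over `K`, which gives access to the library's calculus of
derivations. -/
def ratDerivation : Derivation K (RatFunc K) (RatFunc K) where
  toFun := ratDeriv
  map_add' := ratDeriv_add
  map_smul' a f := by
    simp [RatFunc.smul_eq_C_mul, ratDeriv_mul, ratDeriv_C]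
  map_one_eq_zero' := by simpa using ratDeriv_C (1 : K)
  leibniz' := ratDeriv_mul

@[simp] theorem ratDerivation_apply (f : RatFunc K) : ratDerivation K f = ratDeriv f := rfl

theorem ratDeriv_eq_zero_iff [CharZero K] {f : RatFunc K} :
    ratDeriv f = 0 ↔ ∃ a, f = RatFunc.C a := by
  refine ⟨fun h => ?_, fun ⟨a, ha⟩ => ha ▸ ratDeriv_C a⟩
  have hwronskian : f.num.wronskian f.denom = 0 := by
    rw [ratDeriv, div_eq_zero_iff, or_iff_left (by simp [f.denom_ne_zero]),
      map_eq_zero_iff _ (RatFunc.algebraMap_injective K)] at h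
    rw [wronskian]
    linear_combination -h
  obtain ⟨hnum, hdenom⟩ := f.isCoprime_num_denom.wronskian_eq_zero_iff.mp hwronskian
  refine ⟨f.num.coeff 0 / f.denom.coeff 0, ?_⟩
  conv_lhs => rw [← f.num_div_denom, eq_C_of_derivative_eq_zero hnum,
    eq_C_of_derivative_eq_zero hdenom]
  simp only [RatFunc.algebraMap_C, map_div₀]

end Derivation

/-! ### Substitution into rational functions -/

section Substitution

variable {k A : Type*} [Field k] [Field A] [Algebra k A] {g : A}

theorem aeval_ne_zero_of_transcendental (hg : Transcendental k g) {p : k[X]} (hp : p ≠ 0) :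
    aeval g p ≠ 0 :=
  fun h => hp (transcendental_iff.mp hg p h)

/-- The homomorphism `f ↦ f(g)` of substitution of a transcendental element `g` into rational
functions. -/
def subst (g : A) (hg : Transcendental k g) : RatFunc k →ₐ[k] A :=
  RatFunc.liftAlgHom (aeval g) fun _ hp => mem_nonZeroDivisors_of_ne_zero
    (aeval_ne_zero_of_transcendental hg (nonZeroDivisors.ne_zero hp))

variable (hg : Transcendental k g)

theorem subst_apply (f : RatFunc k) : subst g hg f = aeval g f.num / aeval g f.denom :=
  RatFunc.liftAlgHom_apply ..

theorem subst_algebraMap (p : k[X]) :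
    subst g hg (algebraMap k[X] (RatFunc k) p) = aeval g p := by
  simpa [subst] using RatFunc.liftAlgHom_apply_div (aeval g) _ p 1

theorem subst_X : subst g hg RatFunc.X = g := by
  rw [← RatFunc.algebraMap_X, subst_algebraMap, aeval_X]

theorem subst_C (a : k) : subst g hg (RatFunc.C a) = algebraMap k A a := by
  rw [← RatFunc.algebraMap_C, subst_algebraMap, aeval_C]

theorem ratDeriv_subst {L : Type*} [Field L] [Algebra k L] {g : RatFunc L}
    (hg : Transcendental k g) (f : RatFunc k) :
    ratDeriv (subst g hg f) = subst g hg (ratDeriv f) * ratDeriv g := by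
  have ratDeriv_aeval (p : k[X]) : ratDeriv (aeval g p) = aeval g (derivative p) * ratDeriv g :=
    Derivation.comp_aeval_eq g ((ratDerivation L).restrictScalars k) p
  induction f using RatFunc.induction_on with | _ p q hq
  have hq' := aeval_ne_zero_of_transcendental hg hq
  rw [ratDeriv_div p q hq]
  simp only [map_div₀, subst_algebraMap, map_sub, map_mul, map_pow]
  rw [← ratDerivation_apply, Derivation.leibniz_div]
  simp only [ratDerivation_apply, ratDeriv_aeval, smul_eq_mul]
  field_simp

end Substitution

/-! ### Specialization of fractions -/

section Specialization

variable {R L₁ L₂ : Type*} [CommRing R] [Field L₁] [Field L₂] {ι : R →+* L₁} {σ : R →+* L₂}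

/-- If `x` is a fraction of elements of `R` in `L₁`, then `y` is its image under a place extending
`σ`: reading the fraction in `L₂` gives `y`, and its denominator does not vanish there. Evaluation
of rational functions at a point or at a value of a parameter, and the passage from the generic
point of a curve to another point of it, are all of this kind. -/
def SpecializesTo (ι : R →+* L₁) (σ : R →+* L₂) (x : L₁) (y : L₂) : Prop :=
  ∃ p q : R, σ q ≠ 0 ∧ x * ι q = ι p ∧ y * σ q = σ p

namespace SpecializesTo

variable {x x' : L₁} {y y' : L₂}

theorem of_ring (r : R) : SpecializesTo ι σ (ι r) (σ r) :=
  ⟨r, 1, by simp, by simp, by simp⟩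

theorem add (h : SpecializesTo ι σ x y) (h' : SpecializesTo ι σ x' y') :
    SpecializesTo ι σ (x + x') (y + y') := by
  obtain ⟨p, q, hq, hx, hy⟩ := h
  obtain ⟨p', q', hq', hx', hy'⟩ := h'
  refine ⟨p * q' + p' * q, q * q', by simp [hq, hq'], ?_, ?_⟩ <;>
    simp only [map_add, map_mul, ← hx, ← hx', ← hy, ← hy'] <;> ring

theorem mul (h : SpecializesTo ι σ x y) (h' : SpecializesTo ι σ x' y') :
    SpecializesTo ι σ (x * x') (y * y') := by
  obtain ⟨p, q, hq, hx, hy⟩ := h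
  obtain ⟨p', q', hq', hx', hy'⟩ := h'
  refine ⟨p * p', q * q', by simp [hq, hq'], ?_, ?_⟩ <;>
    simp only [map_mul, ← hx, ← hx', ← hy, ← hy'] <;> ring

theorem eq_zero (hker : RingHom.ker ι ≤ RingHom.ker σ) (h : SpecializesTo ι σ 0 y) : y = 0 := by
  obtain ⟨p, q, hq, hx, hy⟩ := h
  have hp : σ p = 0 := hker (by rw [RingHom.mem_ker, ← hx, zero_mul])
  exact (mul_eq_zero.mp (hy.trans hp)).resolve_right hq

theorem unique (hker : RingHom.ker ι ≤ RingHom.ker σ) (h : SpecializesTo ι σ x y)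
    (h' : SpecializesTo ι σ x y') : y = y' := by
  have hsub := h.add ((of_ring (-1)).mul h')
  simp only [map_neg, map_one, neg_one_mul, add_neg_cancel] at hsub
  exact add_neg_eq_zero.mp (hsub.eq_zero hker)

theorem inv (hker : RingHom.ker ι ≤ RingHom.ker σ) (h : SpecializesTo ι σ x y) (hy : y ≠ 0) :
    SpecializesTo ι σ x⁻¹ y⁻¹ := by
  have hx : x ≠ 0 := by
    rintro rfl
    exact hy (h.eq_zero hker)
  obtain ⟨p, q, hq, hxq, hyq⟩ := h
  exact ⟨q, p, hyq ▸ mul_ne_zero hy hq, by rw [← hxq, inv_mul_cancel_left₀ hx],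
    by rw [← hyq, inv_mul_cancel_left₀ hy]⟩

theorem div (hker : RingHom.ker ι ≤ RingHom.ker σ) (h : SpecializesTo ι σ x y)
    (h' : SpecializesTo ι σ x' y') (hy' : y' ≠ 0) : SpecializesTo ι σ (x / x') (y / y') := by
  simpa only [div_eq_mul_inv] using h.mul (h'.inv hker hy')

variable {k : Type*} [Field k] [Algebra k R] [Algebra k L₁] [Algebra k L₂]

theorem mvAeval {s : Type*} {v : s → L₁} {w : s → L₂}
    (hι : ι.comp (algebraMap k R) = algebraMap k L₁)
    (hσ : σ.comp (algebraMap k R) = algebraMap k L₂)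
    (h : ∀ i, SpecializesTo ι σ (v i) (w i)) (G : MvPolynomial s k) :
    SpecializesTo ι σ (MvPolynomial.aeval v G) (MvPolynomial.aeval w G) := by
  induction G using MvPolynomial.induction_on with
  | C c =>
    rw [MvPolynomial.aeval_C, MvPolynomial.aeval_C, ← hι, ← hσ]
    exact of_ring _
  | add G₁ G₂ h₁ h₂ => simpa only [map_add] using h₁.add h₂
  | mul_X G i hG => simpa only [map_mul, MvPolynomial.aeval_X] using hG.mul (h i)

theorem aeval (hι : ι.comp (algebraMap k R) = algebraMap k L₁)
    (hσ : σ.comp (algebraMap k R) = algebraMap k L₂) (h : SpecializesTo ι σ x y) (p : k[X]) :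
    SpecializesTo ι σ (Polynomial.aeval x p) (Polynomial.aeval y p) := by
  simpa only [MvPolynomial.aeval_toMvPolynomial] using
    mvAeval hι hσ (fun _ : Unit => h) (p.toMvPolynomial ())

theorem aeval_eq_mul_aeval (hι : ι.comp (algebraMap k R) = algebraMap k L₁)
    (hσ : σ.comp (algebraMap k R) = algebraMap k L₂) (hker : RingHom.ker ι ≤ RingHom.ker σ)
    (hx : SpecializesTo ι σ x y) (hx' : SpecializesTo ι σ x' y') {p q : k[X]}
    (h : Polynomial.aeval x p = x' * Polynomial.aeval x q) :
    Polynomial.aeval y p = y' * Polynomial.aeval y q :=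
  (hx.aeval hι hσ p).unique hker (h ▸ hx'.mul (hx.aeval hι hσ q))

end SpecializesTo

end Specialization

/-! ### Values of rational functions -/

section Values

theorem aeval_denom_ne_zero {k A : Type*} [Field k] [Field A] [Algebra k A] {f : RatFunc k}
    {a b : A} (h : aeval a f.num = b * aeval a f.denom) : aeval a f.denom ≠ 0 := by
  intro hdenom
  obtain ⟨u, v, huv⟩ := f.isCoprime_num_denom
  simpa [h, hdenom] using congrArg (aeval a) huv

variable {K : Type*} [Field K]

/-- The rational function `f` has no pole at `a`, and its value there is `b`. -/
def HasValueAt (f : RatFunc K) (a b : K) : Prop :=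
  SpecializesTo (algebraMap K[X] (RatFunc K)) (evalRingHom a) f b

variable {f : RatFunc K} {a b b' : K}

theorem ker_algebraMap_le {S : Type*} [CommRing S] (σ : K[X] →+* S) :
    RingHom.ker (algebraMap K[X] (RatFunc K)) ≤ RingHom.ker σ := by
  rw [(RingHom.injective_iff_ker_eq_bot _).mp (RatFunc.algebraMap_injective K)]
  exact bot_le

theorem hasValueAt_iff : HasValueAt f a b ↔ aeval a f.num = b * aeval a f.denom := by
  simp only [coe_aeval_eq_eval]
  constructor
  · rintro ⟨p, q, hq, hf, hb⟩
    rw [coe_evalRingHom] at hq hb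
    have hq0 : q ≠ 0 := by rintro rfl; exact hq eval_zero
    have hcross : f.num * q = p * f.denom := (RatFunc.num_mul_eq_mul_denom_iff hq0).mpr
      ((eq_div_iff (RatFunc.algebraMap_ne_zero hq0)).mpr hf)
    have heval := congrArg (eval a) hcross
    rw [eval_mul, eval_mul, ← hb] at heval
    exact mul_right_cancel₀ hq (by linear_combination heval)
  · intro h
    refine ⟨f.num, f.denom, aeval_denom_ne_zero h, ?_, h.symm⟩
    exact (eq_div_iff (RatFunc.algebraMap_ne_zero f.denom_ne_zero)).mp f.num_div_denom.symm

theorem hasValueAt_iff_isRoot : HasValueAt f a b ↔ (f.num - C b * f.denom).IsRoot a := by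
  rw [hasValueAt_iff, IsRoot.def, eval_sub, eval_mul, eval_C, sub_eq_zero, coe_aeval_eq_eval]

theorem hasValueAt_iff_value {f : RatFunc ℂ} {t y : ℂ} :
    HasValueAt f t y ↔ DefinedAt f t ∧ y = value f t := by
  rw [hasValueAt_iff, DefinedAt, value, RatFunc.eval, ← coe_aeval_eq_eval]
  constructor
  · intro h
    have hdenom := aeval_denom_ne_zero h
    exact ⟨hdenom, (eq_div_iff hdenom).mpr h.symm⟩
  · rintro ⟨hdenom, hy⟩
    exact ((eq_div_iff hdenom).mp hy).symm

namespace HasValueAt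

theorem X (a : K) : HasValueAt RatFunc.X a a := by
  have h := SpecializesTo.of_ring (ι := algebraMap K[X] (RatFunc K)) (σ := evalRingHom a) .X
  rwa [RatFunc.algebraMap_X, coe_evalRingHom, eval_X] at h

theorem C (a b : K) : HasValueAt (RatFunc.C b) a b := by
  have h := SpecializesTo.of_ring (ι := algebraMap K[X] (RatFunc K)) (σ := evalRingHom a)
    (Polynomial.C b)
  rwa [RatFunc.algebraMap_C, coe_evalRingHom, eval_C] at h

theorem unique (h : HasValueAt f a b) (h' : HasValueAt f a b') : b = b' :=
  SpecializesTo.unique (ker_algebraMap_le _) h h'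

theorem mvAeval {k s : Type*} [Field k] [Algebra k K] {v : s → RatFunc K} {w : s → K}
    (h : ∀ i, HasValueAt (v i) a (w i)) (G : MvPolynomial s k) :
    HasValueAt (MvPolynomial.aeval v G) a (MvPolynomial.aeval w G) :=
  SpecializesTo.mvAeval (IsScalarTower.algebraMap_eq k K[X] (RatFunc K)).symm
    (by ext c; simp) h G

theorem aeval {k : Type*} [Field k] [Algebra k K] (h : HasValueAt f a b) (p : k[X]) :
    HasValueAt (Polynomial.aeval f p) a (Polynomial.aeval b p) :=
  SpecializesTo.aeval (IsScalarTower.algebraMap_eq k K[X] (RatFunc K)).symm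
    (by ext c; simp) h p

theorem of_subst {k : Type*} [Field k] [Algebra k K] (hf : Transcendental k f) {g : RatFunc k}
    (h : HasValueAt f a b) (h' : HasValueAt (FirstOrderADE.subst f hf g) a b') :
    Polynomial.aeval b g.num = b' * Polynomial.aeval b g.denom := by
  refine SpecializesTo.aeval_eq_mul_aeval
    (IsScalarTower.algebraMap_eq k K[X] (RatFunc K)).symm (by ext c; simp) (ker_algebraMap_le _)
    h h' ?_
  rw [subst_apply,
    div_mul_cancel₀ _ (aeval_ne_zero_of_transcendental hf g.denom_ne_zero)]

theorem subst {k : Type*} [Field k] [Algebra k K] (hf : Transcendental k f) {g : RatFunc k}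
    (h : HasValueAt f a b) (hdenom : Polynomial.aeval b g.denom ≠ 0) :
    HasValueAt (FirstOrderADE.subst f hf g) a
      (Polynomial.aeval b g.num / Polynomial.aeval b g.denom) := by
  rw [subst_apply]
  exact SpecializesTo.div (ker_algebraMap_le _) (h.aeval _) (h.aeval _) hdenom

end HasValueAt

theorem finite_setOf_hasValueAt (hf : ¬ ∃ c, f = RatFunc.C c) (b : K) :
    {a | HasValueAt f a b}.Finite := by
  classical
  have hpoly : f.num - C b * f.denom ≠ 0 := by
    intro h
    refine hf ⟨b, ?_⟩
    have hcross : f.num * 1 = C b * f.denom := by linear_combination h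
    simpa using (RatFunc.num_mul_eq_mul_denom_iff one_ne_zero).mp hcross
  refine (f.num - C b * f.denom).roots.toFinset.finite_toSet.subset fun a ha => ?_
  simpa [hpoly] using hasValueAt_iff_isRoot.mp ha

theorem finite_setOf_not_hasValueAt (f : RatFunc K) : {a | ¬ ∃ b, HasValueAt f a b}.Finite := by
  classical
  refine f.denom.roots.toFinset.finite_toSet.subset fun a ha => ?_
  by_contra hdenom
  have hdenom' : aeval a f.denom ≠ 0 := by simpa [f.denom_ne_zero] using hdenom
  exact ha ⟨_, hasValueAt_iff.mpr (div_mul_cancel₀ _ hdenom').symm⟩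

end Values

/-! ### Solutions in rational functions and general solutions -/

section Solutions

/-- The rational function `w ∈ L(X)` is a solution of `F(w, w') = 0` that is not constant, where
the constants of the equation lie in a subfield `k` of `L`. -/
structure IsNonconstantSolution {k L : Type*} [Field k] [Field L] [Algebra k L]
    (F : MvPolynomial (Fin 2) k) (w : RatFunc L) : Prop where
  aeval_eq_zero : MvPolynomial.aeval ![w, ratDeriv w] F = 0
  ratDeriv_ne_zero : ratDeriv w ≠ 0

variable {k L : Type*} [Field k] [Field L] [Algebra k L]

theorem transcendental_of_ratDeriv_ne_zero [CharZero L] {g : RatFunc L} (hg : ratDeriv g ≠ 0) :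
    Transcendental k g := by
  have hL : Transcendental L g :=
    RatFunc.transcendental_of_ne_C g fun h => hg (ratDeriv_eq_zero_iff.mpr h)
  exact fun hk => hL (hk.extendScalars (algebraMap k L).injective)

theorem aeval_pair_algHom {A B : Type*} [CommRing A] [CommRing B] [Algebra k A] [Algebra k B]
    (σ : A →ₐ[k] B) (x y : A) (F : MvPolynomial (Fin 2) k) :
    MvPolynomial.aeval ![σ x, σ y] F = σ (MvPolynomial.aeval ![x, y] F) := by
  have hpair : ![σ x, σ y] = σ ∘ ![x, y] := by
    ext i
    fin_cases i <;> rfl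
  rw [hpair]
  exact (MvPolynomial.comp_aeval_apply _ _ _).symm

/-- The homomorphism `R[X] → L(X)` given by `s` on the coefficients. It describes the passage from
a family of rational functions, with parameters in `R`, to one of its members. -/
def coeffMap {R : Type*} [CommRing R] (s : R →+* L) : R[X] →+* RatFunc L :=
  (algebraMap L[X] (RatFunc L)).comp (mapRingHom s)

theorem coeffMap_apply {R : Type*} [CommRing R] (s : R →+* L) (p : R[X]) :
    coeffMap s p = algebraMap L[X] (RatFunc L) (p.map s) := rfl

theorem coeffMap_eq_zero_iff {R : Type*} [CommRing R] {s : R →+* L} {p : R[X]} :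
    coeffMap s p = 0 ↔ p.map s = 0 := by
  rw [coeffMap_apply, map_eq_zero_iff _ (RatFunc.algebraMap_injective L)]

theorem coeffMap_comp_algebraMap {R : Type*} [CommRing R] [Algebra k R] {s : R →+* L}
    (hs : s.comp (algebraMap k R) = algebraMap k L) :
    (coeffMap s).comp (algebraMap k R[X]) = algebraMap k (RatFunc L) := by
  rw [IsScalarTower.algebraMap_eq k L[X] (RatFunc L), coeffMap, RingHom.comp_assoc]
  congr 1
  ext c
  simp [Polynomial.algebraMap_apply, ← hs]

theorem exists_mul_coeffMap_eq {A : Type*} [CommRing A] [IsDomain A] [Algebra A L]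
    [IsFractionRing A L] (w : RatFunc L) : ∃ P Q : A[X], Q ≠ 0 ∧
      w * coeffMap (algebraMap A L) Q = coeffMap (algebraMap A L) P := by
  obtain ⟨b, hb, hnum⟩ := IsLocalization.integerNormalization_spec (nonZeroDivisors A) w.num
  obtain ⟨c, hc, hdenom⟩ := IsLocalization.integerNormalization_spec (nonZeroDivisors A) w.denom
  set P := IsLocalization.integerNormalization (nonZeroDivisors A) w.num
  set Q := IsLocalization.integerNormalization (nonZeroDivisors A) w.denom
  have hP : (C c * P).map (algebraMap A L) = C (algebraMap A L (b * c)) * w.num := by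
    rw [Polynomial.map_mul, map_C, hnum, ← algebraMap_smul L b, smul_eq_C_mul, map_mul, C_mul]
    ring
  have hQ : (C b * Q).map (algebraMap A L) = C (algebraMap A L (b * c)) * w.denom := by
    rw [Polynomial.map_mul, map_C, hdenom, ← algebraMap_smul L c, smul_eq_C_mul, map_mul, C_mul]
    ring
  have hbc : algebraMap A L (b * c) ≠ 0 :=
    IsFractionRing.to_map_ne_zero_of_mem_nonZeroDivisors (mul_mem hb hc)
  refine ⟨C c * P, C b * Q, fun h => ?_, ?_⟩
  · rw [h, Polynomial.map_zero] at hQ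
    exact mul_ne_zero (C_ne_zero.mpr hbc) w.denom_ne_zero hQ.symm
  · have hw : w * algebraMap L[X] (RatFunc L) w.denom = algebraMap L[X] (RatFunc L) w.num :=
      (eq_div_iff (RatFunc.algebraMap_ne_zero w.denom_ne_zero)).mp w.num_div_denom.symm
    rw [coeffMap_apply, coeffMap_apply, hP, hQ, map_mul, map_mul _ _ w.num, ← hw]
    ring

theorem ratDeriv_mul_coeffMap_eq {R : Type*} [CommRing R] {s : R →+* L} {P Q : R[X]}
    (hQ : coeffMap s Q ≠ 0) {w : RatFunc L} (hw : w * coeffMap s Q = coeffMap s P) :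
    ratDeriv w * coeffMap s (Q ^ 2) = coeffMap s (derivative P * Q - P * derivative Q) := by
  have hQ' : Q.map s ≠ 0 := mt coeffMap_eq_zero_iff.mpr hQ
  rw [← eq_div_iff hQ] at hw
  rw [← eq_div_iff (by simpa only [map_pow] using pow_ne_zero 2 hQ), hw, coeffMap_apply,
    coeffMap_apply, ratDeriv_div _ _ hQ']
  rw [coeffMap_apply, coeffMap_apply, Polynomial.map_sub, Polynomial.map_mul, Polynomial.map_mul,
    Polynomial.map_pow, derivative_map, derivative_map]

theorem exists_map_evalRingHom_ne_zero [Infinite k] {H : k[X][X]} (hH : H ≠ 0) :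
    ∃ l : k, H.map (evalRingHom l) ≠ 0 := by
  by_contra! hzero
  refine leadingCoeff_ne_zero.mpr hH (Polynomial.funext fun l => ?_)
  simpa only [coeff_map, coe_evalRingHom, coeff_natDegree, coeff_zero, eval_zero] using
    congrArg (coeff · H.natDegree) (hzero l)

theorem IsNonconstantSolution.exists_specialization [CharZero k] {F : MvPolynomial (Fin 2) k}
    {w : RatFunc (RatFunc k)} (hw : IsNonconstantSolution F w) :
    ∃ f : RatFunc k, IsNonconstantSolution F f := by
  have hinj := RatFunc.algebraMap_injective k
  obtain ⟨P, Q, hQ, hwPQ⟩ := exists_mul_coeffMap_eq (A := k[X]) w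
  set ι := coeffMap (algebraMap k[X] (RatFunc k)) with hι
  have hι0 {p : k[X][X]} : ι p = 0 ↔ p = 0 := by
    rw [hι, coeffMap_eq_zero_iff, Polynomial.map_eq_zero_iff hinj]
  set W := derivative P * Q - P * derivative Q
  have hwW : ratDeriv w * ι (Q ^ 2) = ι W := ratDeriv_mul_coeffMap_eq (mt hι0.mp hQ) hwPQ
  have hW : W ≠ 0 := by
    refine mt hι0.mpr ?_
    rw [← hwW]
    exact mul_ne_zero hw.ratDeriv_ne_zero (mt hι0.mp (pow_ne_zero 2 hQ))
  obtain ⟨l, hl⟩ := exists_map_evalRingHom_ne_zero (mul_ne_zero hQ hW)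
  set σ : k[X][X] →+* RatFunc k := coeffMap (evalRingHom l) with hσ
  have hσQW : σ Q * σ W ≠ 0 := by rwa [← map_mul, hσ, Ne, coeffMap_eq_zero_iff]
  have hσQ : σ Q ≠ 0 := left_ne_zero_of_mul hσQW
  have hfPQ : σ P / σ Q * σ Q = σ P := div_mul_cancel₀ _ hσQ
  have hfW : ratDeriv (σ P / σ Q) * σ (Q ^ 2) = σ W := ratDeriv_mul_coeffMap_eq hσQ hfPQ
  refine ⟨σ P / σ Q, ?_, fun h => right_ne_zero_of_mul hσQW (by rw [← hfW, h, zero_mul])⟩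
  have hspec : SpecializesTo ι σ (MvPolynomial.aeval ![w, ratDeriv w] F)
      (MvPolynomial.aeval ![σ P / σ Q, ratDeriv (σ P / σ Q)] F) := by
    refine .mvAeval (coeffMap_comp_algebraMap (IsScalarTower.algebraMap_eq k k[X] _).symm)
      (coeffMap_comp_algebraMap (by ext c; simp)) (Fin.forall_fin_two.mpr ⟨⟨P, Q, hσQ, hwPQ, hfPQ⟩,
      ⟨W, Q ^ 2, by simpa only [map_pow] using pow_ne_zero 2 hσQ, hwW, hfW⟩⟩) F
  rw [hw.aeval_eq_zero] at hspec
  exact hspec.eq_zero fun p hp => by rw [hι0.mp hp]; exact zero_mem _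

end Solutions

section GeneralSolutions

theorem transcendental_zVar : Transcendental ℂ zVar :=
  transcendental_of_ratDeriv_ne_zero (by rw [zVar, ratDeriv_X]; exact one_ne_zero)

theorem ofZ_eq_subst (v : RatFunc ℂ) : ofZ v = subst zVar transcendental_zVar v :=
  (subst_apply transcendental_zVar v).symm

theorem ratDeriv_zVar_add_lamVar : ratDeriv (zVar + lamVar) = 1 := by
  rw [ratDeriv_add, zVar, lamVar, ratDeriv_X, ratDeriv_C, add_zero]

theorem transcendental_zVar_add_lamVar : Transcendental ℂ (zVar + lamVar) :=
  transcendental_of_ratDeriv_ne_zero (by rw [ratDeriv_zVar_add_lamVar]; exact one_ne_zero)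

theorem hasValueAt_ofZ {v : RatFunc ℂ} {c d : ℂ} (h : HasValueAt v c d) :
    HasValueAt (ofZ v) (RatFunc.C c) (RatFunc.C d) := by
  have hC (p : ℂ[X]) : aeval (RatFunc.C c : RatFunc ℂ) p = RatFunc.C (aeval c p) :=
    aeval_algebraMap_apply _ c p
  rw [hasValueAt_iff] at h
  have hdenom := aeval_denom_ne_zero h
  rw [ofZ_eq_subst]
  convert (HasValueAt.X (RatFunc.C c)).subst transcendental_zVar (g := v) ?_ using 1
  · rw [hC, hC, h, map_mul, mul_div_cancel_right₀ _ (by simpa using hdenom)]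
  · rw [hC]
    simpa using hdenom

theorem subst_zVar_add_lamVar_ne_ofZ {f : RatFunc ℂ} (hf : ratDeriv f ≠ 0)
    (v : RatFunc ℂ) : subst (zVar + lamVar) transcendental_zVar_add_lamVar f ≠ ofZ v := by
  intro heq
  obtain ⟨c, hc⟩ := (finite_setOf_not_hasValueAt v).infinite_compl.nonempty
  obtain ⟨d, hd⟩ := not_not.mp hc
  have htr : Transcendental ℂ (RatFunc.C c + RatFunc.X : RatFunc ℂ) :=
    transcendental_of_ratDeriv_ne_zero (by
      rw [ratDeriv_add, ratDeriv_X, ratDeriv_C, zero_add]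
      exact one_ne_zero)
  have hpoint : HasValueAt (zVar + lamVar) (RatFunc.C c) (RatFunc.C c + RatFunc.X) :=
    SpecializesTo.add (HasValueAt.X _) (HasValueAt.C _ _)
  have hvalue := hpoint.subst transcendental_zVar_add_lamVar
    (aeval_ne_zero_of_transcendental htr f.denom_ne_zero)
  rw [heq, ← subst_apply htr] at hvalue
  have hconst : subst _ htr f = subst _ htr (RatFunc.C d) := by
    rw [subst_C]
    exact hvalue.unique (hasValueAt_ofZ hd)
  exact hf (ratDeriv_eq_zero_iff.mpr ⟨d, (subst _ htr).injective hconst⟩)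

theorem IsNonconstantSolution.isRationalGeneralSolution_subst {F : MvPolynomial (Fin 2) ℂ}
    {f : RatFunc ℂ} (hf : IsNonconstantSolution F f) :
    IsRationalGeneralSolution F (subst (zVar + lamVar) transcendental_zVar_add_lamVar f) where
  solves := by
    rw [ratDeriv_subst, ratDeriv_zVar_add_lamVar, mul_one, aeval_pair_algHom, hf.aeval_eq_zero,
      map_zero]
  depends := subst_zVar_add_lamVar_ne_ofZ hf.ratDeriv_ne_zero

theorem hasNonconstantRationalGeneralSolution_iff {F : MvPolynomial (Fin 2) ℂ} :
    HasNonconstantRationalGeneralSolution F ↔ ∃ f : RatFunc ℂ, IsNonconstantSolution F f := by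
  constructor
  · rintro ⟨w, hw, hconst⟩
    exact IsNonconstantSolution.exists_specialization
      ⟨hw.solves, fun h => hconst (ratDeriv_eq_zero_iff.mp h)⟩
  · rintro ⟨f, hf⟩
    refine ⟨_, hf.isRationalGeneralSolution_subst, fun hconst => hf.ratDeriv_ne_zero ?_⟩
    have hderiv := ratDeriv_eq_zero_iff.mpr hconst
    rwa [ratDeriv_subst, ratDeriv_zVar_add_lamVar, mul_one, map_eq_zero] at hderiv

theorem ratDeriv_inv_X {K : Type*} [Field K] :
    ratDeriv (RatFunc.X⁻¹ : RatFunc K) = -RatFunc.X⁻¹ ^ 2 := by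
  rw [← ratDerivation_apply, Derivation.leibniz_inv, ratDerivation_apply, ratDeriv_X, smul_eq_mul,
    mul_one]

theorem isRationalGeneralSolution_riccati :
    IsRationalGeneralSolution (MvPolynomial.X 1 + MvPolynomial.X 0 ^ 2) (1 / (zVar + lamVar)) := by
  have hsol : IsNonconstantSolution
      (MvPolynomial.X 1 + MvPolynomial.X 0 ^ 2 : MvPolynomial (Fin 2) ℂ)
      (RatFunc.X⁻¹ : RatFunc ℂ) := by
    refine ⟨?_, ?_⟩
    · simp [ratDeriv_inv_X]
    · simp [ratDeriv_inv_X, RatFunc.X_ne_zero]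
  convert hsol.isRationalGeneralSolution_subst using 1
  rw [map_inv₀, subst_X]
  exact one_div (zVar + lamVar)

end GeneralSolutions

/-! ### Differential fields -/

section DifferentialFields

open scoped Differential

/-- The implicit derivative of the minimal polynomial of `z` still kills `z` and has lower degree,
hence it vanishes; its coefficient next to the top yields `a`. -/
theorem exists_deriv_eq_of_isIntegral {K L : Type*} [Field K] [CharZero K] [Field L]
    [Differential K] [Differential L] [Algebra K L] [DifferentialAlgebra K L] {z : L}
    (hz : IsIntegral K z) {b : K} (hb : z′ = algebraMap K L b) : ∃ a : K, a′ = b := by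
  set p := minpoly K z
  have hmonic : p.Monic := minpoly.monic hz
  obtain ⟨n, hn⟩ := Nat.exists_eq_add_one.mpr (minpoly.natDegree_pos hz)
  have leadingCoeff_p : p.coeff (n + 1) = 1 := hn ▸ hmonic.coeff_natDegree
  set q := Differential.implicitDeriv (C b) p
  have coeff_q (i : ℕ) : q.coeff i = (p.coeff i)′ + b * (p.coeff (i + 1) * (i + 1)) := by
    simp [q, Differential.implicitDeriv, coeff_derivative]
  have aeval_q : aeval z q = 0 := by
    rw [← Differential.deriv_aeval_eq_implicitDeriv z (C b) (by rw [hb, aeval_C]),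
      minpoly.aeval, map_zero]
  have degree_q : q.degree < p.degree := by
    rw [degree_eq_natDegree hmonic.ne_zero, degree_lt_iff_coeff_zero]
    intro i hi
    rw [coeff_q, coeff_eq_zero_of_natDegree_lt (Nat.lt_succ_of_le hi), zero_mul, mul_zero, add_zero]
    rcases hi.eq_or_lt with rfl | hi
    · rw [hmonic.coeff_natDegree, Derivation.map_one_eq_zero]
    · rw [coeff_eq_zero_of_natDegree_lt hi, map_zero]
  have hq : q = 0 := by
    by_contra hq
    exact (minpoly.degree_le_of_ne_zero K z hq aeval_q).not_gt degree_q
  have hcoeff : (p.coeff n)′ + b * (n + 1) = 0 := by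
    simpa [hq, hn, leadingCoeff_p] using (coeff_q n).symm
  have hn' : ((n + 1 : ℕ) : K) ≠ 0 := Nat.cast_ne_zero.mpr n.succ_ne_zero
  refine ⟨-p.coeff n / (n + 1 : ℕ), ?_⟩
  rw [Derivation.leibniz_div]
  simp only [Derivation.map_natCast, map_neg, smul_eq_mul, mul_zero, sub_zero]
  push_cast at hn' ⊢
  field_simp
  linear_combination -hcoeff

variable {k L : Type*} [Field k] [Field L] [Algebra k L] (D : Derivation k L L)

/-- The restriction of a derivation to an intermediate field that it maps to itself. -/
def restrictDerivation (E : IntermediateField k L) (hE : ∀ x ∈ E, D x ∈ E) : Derivation k E E :=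
  .mk' ((D : L →ₗ[k] L).restrict (p := E.toSubmodule) (q := E.toSubmodule) hE)
    fun x y => Subtype.ext (D.leibniz x y)

theorem mem_of_derivation_mem [CharZero k] (hD : ∀ x, D x = 0 → x ∈ (algebraMap k L).range)
    {E : IntermediateField k L} (hE : ∀ x ∈ E, D x ∈ E) {z : L} (halg : IsAlgebraic E z)
    (hz : D z ∈ E) : z ∈ E := by
  let _ : Differential L := ⟨D.restrictScalars ℤ⟩
  let _ : Differential E := ⟨(restrictDerivation D E hE).restrictScalars ℤ⟩
  have : DifferentialAlgebra E L := ⟨fun _ => rfl⟩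
  have : CharZero E := charZero_of_injective_algebraMap (algebraMap k E).injective
  obtain ⟨a, ha⟩ := exists_deriv_eq_of_isIntegral (b := ⟨D z, hz⟩) halg.isIntegral rfl
  have hDa : D a = D z := congrArg Subtype.val ha
  obtain ⟨c, hc⟩ := hD (z - a) (by rw [map_sub, hDa, sub_self])
  rw [← sub_add_cancel z a, ← hc]
  exact E.add_mem (E.algebraMap_mem c) a.2

theorem derivation_mem_adjoin {S : Set L} (hS : ∀ x ∈ S, D x ∈ IntermediateField.adjoin k S) :
    ∀ x ∈ IntermediateField.adjoin k S, D x ∈ IntermediateField.adjoin k S := by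
  intro x hx
  induction hx using IntermediateField.adjoin_induction with
  | mem x hx => exact hS x hx
  | algebraMap x =>
    rw [Derivation.map_algebraMap]
    exact zero_mem _
  | add x y _ _ hDx hDy =>
    rw [map_add]
    exact add_mem hDx hDy
  | inv x hx hDx =>
    rw [Derivation.leibniz_inv]
    exact mul_mem (neg_mem (pow_mem (inv_mem hx) 2)) hDx
  | mul x y hx hy hDx hDy =>
    rw [Derivation.leibniz]
    exact add_mem (mul_mem hx hDy) (mul_mem hy hDx)

theorem derivation_mvAeval {ι : Type*} [Fintype ι] (v : ι → L) (F : MvPolynomial ι k) :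
    D (MvPolynomial.aeval v F) =
      ∑ i, MvPolynomial.aeval v (MvPolynomial.pderiv i F) * D (v i) := by
  classical
  induction F using MvPolynomial.induction_on with
  | C a => simp
  | add p q hp hq => simp only [map_add, hp, hq, add_mul, Finset.sum_add_distrib]
  | mul_X p j hp =>
    simp only [map_mul, MvPolynomial.aeval_X, Derivation.leibniz, hp, MvPolynomial.pderiv_X,
      smul_eq_mul, map_add, add_mul, Finset.sum_add_distrib, Finset.mul_sum]
    congr 1
    · rw [Finset.sum_eq_single j] <;> simp +contextual
    · simp only [mul_assoc]

end DifferentialFields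

/-! ### Irreducible plane curves -/

section PlaneCurves

theorem exists_mul_add_mul_eq_C {R : Type*} [CommRing R] [IsDomain R] [IsGCDMonoid R]
    {f g : R[X]} (hf : Irreducible f) (hdeg : 0 < f.natDegree) (hfg : ¬ f ∣ g) :
    ∃ u v r, r ≠ 0 ∧ f * u + g * v = C r := by
  have hprim : f.IsPrimitive := hf.isPrimitive hdeg.ne'
  have hinj := IsFractionRing.injective R (FractionRing R)
  have hcoprime : IsCoprime (f.map (algebraMap R (FractionRing R)))
      (g.map (algebraMap R (FractionRing R))) :=
    (hprim.irreducible_iff_irreducible_map_fraction_map.mp hf).coprime_iff_not_dvd.mpr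
      fun h => hfg (hprim.dvd_of_fraction_map_dvd_fraction_map h)
  obtain ⟨u, v, -, -, huv⟩ :=
    exists_mul_add_mul_eq_C_resultant f g le_rfl le_rfl (.inl hdeg.ne')
  refine ⟨u, v, _, fun hres => ?_, huv⟩
  have hres' := congrArg (algebraMap R (FractionRing R)) hres
  rw [← resultant_map_map, map_zero, ← natDegree_map_eq_of_injective hinj f,
    ← natDegree_map_eq_of_injective hinj g, resultant_eq_zero_iff] at hres'
  exact hres'.2 hcoprime

variable {k : Type*} [Field k] {F G : MvPolynomial (Fin 2) k}

theorem equivMvPolynomial_C (p : k[X]) :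
    Bivariate.equivMvPolynomial k (C p) = p.toMvPolynomial 0 := by
  simp only [Bivariate.equivMvPolynomial, AlgEquiv.ofAlgHom_apply, aevalAeval_C, toMvPolynomial]

theorem degreeOf_toMvPolynomial_of_ne {s R : Type*} [CommSemiring R] {i j : s} (hij : j ≠ i)
    (p : R[X]) : (p.toMvPolynomial i).degreeOf j = 0 := by
  classical
  by_contra hdeg
  have hj := MvPolynomial.mem_vars_iff_degreeOf_ne_zero.mpr hdeg
  rw [toMvPolynomial_eq_rename_comp] at hj
  obtain ⟨_, -, rfl⟩ := MvPolynomial.mem_vars_rename _ _ hj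
  exact hij rfl

theorem natDegree_equivMvPolynomial_symm_pos (hord : 0 < F.degreeOf 1) :
    0 < ((Bivariate.equivMvPolynomial k).symm F).natDegree := by
  refine Nat.pos_of_ne_zero fun h => hord.ne' ?_
  obtain ⟨p, hp⟩ := natDegree_eq_zero.mp h
  rw [← AlgEquiv.apply_symm_apply (Bivariate.equivMvPolynomial k) F, ← hp, equivMvPolynomial_C]
  exact degreeOf_toMvPolynomial_of_ne one_ne_zero p

theorem irreducible_equivMvPolynomial_symm (hF : Irreducible F) :
    Irreducible ((Bivariate.equivMvPolynomial k).symm F) :=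
  (MulEquiv.irreducible_iff (Bivariate.equivMvPolynomial k).symm.toMulEquiv).mpr hF

theorem exists_mul_add_mul_eq_toMvPolynomial (hF : Irreducible F) (hord : 0 < F.degreeOf 1)
    (hFG : ¬ F ∣ G) : ∃ (u v : MvPolynomial (Fin 2) k) (r : k[X]), r ≠ 0 ∧
      F * u + G * v = r.toMvPolynomial 0 := by
  set e := Bivariate.equivMvPolynomial k
  obtain ⟨u, v, r, hr, huv⟩ := exists_mul_add_mul_eq_C (irreducible_equivMvPolynomial_symm hF)
    (natDegree_equivMvPolynomial_symm_pos hord) (mt (map_dvd_iff e.symm).mp hFG)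
  refine ⟨e u, e v, r, hr, ?_⟩
  rw [← equivMvPolynomial_C, ← huv, map_add, map_mul, map_mul, e.apply_symm_apply,
    e.apply_symm_apply]

theorem not_dvd_pderiv_one [CharZero k] (hord : 0 < F.degreeOf 1) :
    ¬ F ∣ MvPolynomial.pderiv 1 F := by
  obtain ⟨f, rfl⟩ := (Bivariate.equivMvPolynomial k).surjective F
  have hdeg := natDegree_equivMvPolynomial_symm_pos hord
  rw [AlgEquiv.symm_apply_apply] at hdeg
  rw [Bivariate.pderiv_one_equivMvPolynomial, map_dvd_iff]
  exact not_dvd_of_natDegree_lt (mt derivative_eq_zero.mp hdeg.ne')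
    (natDegree_derivative_lt hdeg.ne')

theorem dvd_of_aeval_eq_zero {L : Type*} [Field L] [Algebra k L] (hF : Irreducible F)
    (hord : 0 < F.degreeOf 1) {x y : L} (hx : Transcendental k x)
    (hFxy : MvPolynomial.aeval ![x, y] F = 0) (hGxy : MvPolynomial.aeval ![x, y] G = 0) :
    F ∣ G := by
  by_contra hFG
  obtain ⟨u, v, r, hr, huv⟩ := exists_mul_add_mul_eq_toMvPolynomial hF hord hFG
  have heval := congrArg (MvPolynomial.aeval ![x, y]) huv
  rw [map_add, map_mul, map_mul, hFxy, hGxy, zero_mul, zero_mul, add_zero,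
    MvPolynomial.aeval_toMvPolynomial] at heval
  exact aeval_ne_zero_of_transcendental hx hr heval.symm

theorem eval_eq_evalEval_equivMvPolynomial_symm {R : Type*} [CommRing R]
    (F : MvPolynomial (Fin 2) R) (x y : R) :
    MvPolynomial.eval ![x, y] F = ((Bivariate.equivMvPolynomial R).symm F).evalEval x y := by
  induction F using MvPolynomial.induction_on with
  | C a => simp
  | add p q hp hq => simp [hp, hq]
  | mul_X p i hp => fin_cases i <;> simp [hp, evalEval_C]

theorem finite_setOf_eval_eq_zero (hF : Irreducible F) (hord : 0 < F.degreeOf 1) (x : k) :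
    {y : k | MvPolynomial.eval ![x, y] F = 0}.Finite := by
  classical
  set f := (Bivariate.equivMvPolynomial k).symm F with hf
  have hprim : f.IsPrimitive := (irreducible_equivMvPolynomial_symm hF).isPrimitive
    (natDegree_equivMvPolynomial_symm_pos hord).ne'
  have hfx : f.map (evalRingHom x) ≠ 0 := by
    intro hzero
    refine not_isUnit_X_sub_C x (hprim _ ((C_dvd_iff_dvd_coeff _ _).mpr fun i => ?_))
    rw [dvd_iff_isRoot, IsRoot.def]
    simpa using congrArg (coeff · i) hzero
  refine (f.map (evalRingHom x)).roots.toFinset.finite_toSet.subset fun y hy => ?_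
  rw [Set.mem_ofPred_eq, eval_eq_evalEval_equivMvPolynomial_symm, ← hf,
    ← map_evalRingHom_eval] at hy
  simpa [hfx] using hy

theorem finite_setOf_common_zeros (hF : Irreducible F) (hord : 0 < F.degreeOf 1)
    (hFG : ¬ F ∣ G) :
    {p : k × k | MvPolynomial.eval ![p.1, p.2] F = 0 ∧
      MvPolynomial.eval ![p.1, p.2] G = 0}.Finite := by
  classical
  obtain ⟨u, v, r, hr, huv⟩ := exists_mul_add_mul_eq_toMvPolynomial hF hord hFG
  have hfibers : (⋃ x ∈ (r.roots.toFinset : Set k),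
      (fun y => (x, y)) '' {y : k | MvPolynomial.eval ![x, y] F = 0}).Finite :=
    r.roots.toFinset.finite_toSet.biUnion fun x _ =>
      (finite_setOf_eval_eq_zero hF hord x).image _
  refine hfibers.subset ?_
  rintro ⟨x, y⟩ ⟨hFxy, hGxy⟩
  have hrx : r.eval x = 0 := by
    have heval := congrArg (MvPolynomial.eval ![x, y]) huv
    rw [map_add, map_mul, map_mul, hFxy, hGxy, zero_mul, zero_mul, add_zero,
      MvPolynomial.eval_toMvPolynomial] at heval
    exact heval.symm
  simp only [Set.mem_iUnion]
  exact ⟨x, by simpa [hr] using hrx, y, hFxy, rfl⟩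

end PlaneCurves

/-! ### Birational parametrizations -/

section Birational

variable {k : Type*} [Field k] {F : MvPolynomial (Fin 2) k}

theorem ratDeriv_ratDeriv_eq [CharZero k] (hF : Irreducible F) (hord : 0 < F.degreeOf 1)
    {f : RatFunc k} (hf : IsNonconstantSolution F f) :
    ratDeriv (ratDeriv f) =
      -(MvPolynomial.aeval ![f, ratDeriv f] (MvPolynomial.pderiv 0 F) * ratDeriv f) /
        MvPolynomial.aeval ![f, ratDeriv f] (MvPolynomial.pderiv 1 F) := by
  have hsep : MvPolynomial.aeval ![f, ratDeriv f] (MvPolynomial.pderiv 1 F) ≠ 0 := fun h =>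
    not_dvd_pderiv_one hord (dvd_of_aeval_eq_zero hF hord
      (transcendental_of_ratDeriv_ne_zero hf.ratDeriv_ne_zero) hf.aeval_eq_zero h)
  have hderiv := derivation_mvAeval (ratDerivation k) ![f, ratDeriv f] F
  rw [hf.aeval_eq_zero, map_zero, Fin.sum_univ_two] at hderiv
  simp only [ratDerivation_apply, Matrix.cons_val_zero, Matrix.cons_val_one] at hderiv
  rw [eq_div_iff hsep]
  linear_combination -hderiv

/-- The field `k(f, f')` is closed under differentiation, `X` is algebraic over it and `X' = 1`;
hence it contains an antiderivative of `1`, which differs from `X` by a constant. -/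
theorem IsNonconstantSolution.X_mem_adjoin [CharZero k] (hF : Irreducible F)
    (hord : 0 < F.degreeOf 1) {f : RatFunc k} (hf : IsNonconstantSolution F f) :
    RatFunc.X ∈ IntermediateField.adjoin k (Set.range ![f, ratDeriv f]) := by
  set E := IntermediateField.adjoin k (Set.range ![f, ratDeriv f])
  have haeval (G : MvPolynomial (Fin 2) k) : MvPolynomial.aeval ![f, ratDeriv f] G ∈ E :=
    (IntermediateField.mem_adjoin_range_iff k _ _).mpr ⟨G, 1, by simp⟩
  have hfE : f ∈ E := by simpa using haeval (.X 0)
  have hfE' : ratDeriv f ∈ E := by simpa using haeval (.X 1)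
  have hfE'' : ratDeriv (ratDeriv f) ∈ E := by
    rw [ratDeriv_ratDeriv_eq hF hord hf]
    exact div_mem (neg_mem (mul_mem (haeval _) hfE')) (haeval _)
  have hclosed : ∀ x ∈ E, ratDeriv x ∈ E := derivation_mem_adjoin (ratDerivation k)
    (Set.forall_mem_range.mpr (Fin.forall_fin_two.mpr ⟨hfE', hfE''⟩))
  have hne : E ≠ ⊥ := fun hbot => by
    rw [hbot, IntermediateField.mem_bot] at hfE
    obtain ⟨a, ha⟩ := hfE
    exact hf.ratDeriv_ne_zero (ratDeriv_eq_zero_iff.mpr ⟨a, ha.symm⟩)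
  refine mem_of_derivation_mem (ratDerivation k) (fun x hx => ?_) hclosed
    (RatFunc.IntermediateField.isAlgebraic_X hne) ?_
  · obtain ⟨a, rfl⟩ := ratDeriv_eq_zero_iff.mp hx
    exact ⟨a, rfl⟩
  · rw [ratDerivation_apply, ratDeriv_X]
    exact one_mem E

theorem aeval_X_num_eq_mul_aeval_X_denom (f : RatFunc k) :
    aeval RatFunc.X f.num = f * aeval RatFunc.X f.denom := by
  rw [RatFunc.aeval_X_left_eq_algebraMap, RatFunc.aeval_X_left_eq_algebraMap]
  exact (div_eq_iff (RatFunc.algebraMap_ne_zero f.denom_ne_zero)).mp f.num_div_denom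

/-- `(f, g)` is a generic point of the curve `F(x, y) = 0` at which the rational function `A / B`
on the curve takes the value `X`: the pair parametrizes the curve birationally, and `A / B` is the
inverse map. -/
structure IsBirationalPair (F A B : MvPolynomial (Fin 2) k) (f g : RatFunc k) : Prop where
  transcendental : Transcendental k f
  aeval_eq_zero : MvPolynomial.aeval ![f, g] F = 0
  X_eq : RatFunc.X = MvPolynomial.aeval ![f, g] A / MvPolynomial.aeval ![f, g] B

theorem IsNonconstantSolution.exists_isBirationalPair [CharZero k] (hF : Irreducible F)
    (hord : 0 < F.degreeOf 1) {f : RatFunc k} (hf : IsNonconstantSolution F f) :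
    ∃ A B, IsBirationalPair F A B f (ratDeriv f) := by
  obtain ⟨A, B, hX⟩ := (IntermediateField.mem_adjoin_range_iff k _ _).mp (hf.X_mem_adjoin hF hord)
  exact ⟨A, B, transcendental_of_ratDeriv_ne_zero hf.ratDeriv_ne_zero, hf.aeval_eq_zero, hX⟩

theorem transcendental_of_aeval_num_eq {L : Type*} [Field L] [Algebra k L] {f : RatFunc k}
    {m x : L} (hx : Transcendental k x) (h : aeval m f.num = x * aeval m f.denom) :
    Transcendental k m := by
  intro hm
  have hmem : x ∈ IntermediateField.adjoin k {m} :=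
    (IntermediateField.mem_adjoin_simple_iff k x).mpr
      ⟨f.num, f.denom, (eq_div_iff (aeval_denom_ne_zero h)).mpr h.symm⟩
  have := IntermediateField.isAlgebraic_adjoin_simple hm.isIntegral
  exact hx (IntermediateField.isAlgebraic_iff.mp (Algebra.IsAlgebraic.isAlgebraic ⟨x, hmem⟩))

namespace IsBirationalPair

variable {A B : MvPolynomial (Fin 2) k} {f g : RatFunc k} {L : Type*} [Field L] [Algebra k L]
  {x y : L}

theorem aeval_ne_zero (h : IsBirationalPair F A B f g) : MvPolynomial.aeval ![f, g] B ≠ 0 :=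
  fun hB => RatFunc.X_ne_zero (by rw [h.X_eq, hB, div_zero])

theorem not_dvd (h : IsBirationalPair F A B f g) : ¬ F ∣ B := by
  rintro ⟨G, rfl⟩
  exact h.aeval_ne_zero (by rw [map_mul, h.aeval_eq_zero, zero_mul])

theorem aeval_num_eq (hF : Irreducible F) (hord : 0 < F.degreeOf 1)
    (h : IsBirationalPair F A B f g) (hxy : MvPolynomial.aeval ![x, y] F = 0)
    (hB : MvPolynomial.aeval ![x, y] B ≠ 0) {m : L}
    (hm : m = MvPolynomial.aeval ![x, y] A / MvPolynomial.aeval ![x, y] B) :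
    aeval m f.num = x * aeval m f.denom ∧ aeval m g.num = y * aeval m g.denom := by
  set ι := (MvPolynomial.aeval (R := k) ![f, g]).toRingHom
  set σ := (MvPolynomial.aeval (R := k) ![x, y]).toRingHom
  have hker : RingHom.ker ι ≤ RingHom.ker σ := fun G hG => by
    obtain ⟨H, rfl⟩ := dvd_of_aeval_eq_zero hF hord h.transcendental h.aeval_eq_zero hG
    exact (map_mul σ F H).trans (by rw [show σ F = 0 from hxy, zero_mul])
  have hX : SpecializesTo ι σ RatFunc.X m :=
    ⟨A, B, hB, (eq_div_iff h.aeval_ne_zero).mp h.X_eq, (eq_div_iff hB).mp hm⟩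
  have hf : SpecializesTo ι σ f x := by
    simpa [ι, σ] using SpecializesTo.of_ring (ι := ι) (σ := σ) (.X 0)
  have hg : SpecializesTo ι σ g y := by 
    simpa [ι, σ] using SpecializesTo.of_ring (ι := ι) (σ := σ) (.X 1)
  have hι : ι.comp (algebraMap k _) = algebraMap k _ := (MvPolynomial.aeval _).comp_algebraMap
  have hσ : σ.comp (algebraMap k _) = algebraMap k _ := (MvPolynomial.aeval _).comp_algebraMap
  exact ⟨hX.aeval_eq_mul_aeval hι hσ hker hf (aeval_X_num_eq_mul_aeval_X_denom f),
    hX.aeval_eq_mul_aeval hι hσ hker hg (aeval_X_num_eq_mul_aeval_X_denom g)⟩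

theorem hasValueAt (hF : Irreducible F) (hord : 0 < F.degreeOf 1)
    (h : IsBirationalPair F A B f g) {x y : k} (hxy : MvPolynomial.eval ![x, y] F = 0)
    (hB : MvPolynomial.eval ![x, y] B ≠ 0) {t : k}
    (ht : t = MvPolynomial.eval ![x, y] A / MvPolynomial.eval ![x, y] B) :
    HasValueAt f t x ∧ HasValueAt g t y := by
  rw [hasValueAt_iff, hasValueAt_iff]
  exact h.aeval_num_eq hF hord hxy hB ht

theorem eq_div_of_hasValueAt (h : IsBirationalPair F A B f g) {t x y : k} (hf : HasValueAt f t x)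
    (hg : HasValueAt g t y) (hB : MvPolynomial.eval ![x, y] B ≠ 0) :
    t = MvPolynomial.eval ![x, y] A / MvPolynomial.eval ![x, y] B := by
  have hfg : ∀ i, HasValueAt (![f, g] i) t (![x, y] i) := Fin.forall_fin_two.mpr ⟨hf, hg⟩
  have hA := HasValueAt.mvAeval hfg A
  rw [← (eq_div_iff h.aeval_ne_zero).mp h.X_eq] at hA
  rw [eq_div_iff hB]
  exact ((HasValueAt.X t).mul (HasValueAt.mvAeval hfg B)).unique (ker_algebraMap_le _) hA

theorem exists_subst_eq (hF : Irreducible F) (hord : 0 < F.degreeOf 1)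
    (h : IsBirationalPair F A B f g) (hx : Transcendental k x)
    (hxy : MvPolynomial.aeval ![x, y] F = 0) :
    ∃ (m : L) (hm : Transcendental k m), subst m hm f = x ∧ subst m hm g = y := by
  have hB : MvPolynomial.aeval ![x, y] B ≠ 0 := fun hB =>
    h.not_dvd (dvd_of_aeval_eq_zero hF hord hx hxy hB)
  obtain ⟨hfx, hgy⟩ := h.aeval_num_eq hF hord hxy hB rfl
  have hm := transcendental_of_aeval_num_eq hx hfx
  refine ⟨_, hm, ?_, ?_⟩
  · rw [subst_apply, hfx, mul_div_cancel_right₀ _ (aeval_denom_ne_zero hfx)]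
  · rw [subst_apply, hgy, mul_div_cancel_right₀ _ (aeval_denom_ne_zero hgy)]

end IsBirationalPair

end Birational

section Parametrizations

variable {F : MvPolynomial (Fin 2) ℂ} {φ ψ : RatFunc ℂ}

theorem isRationalParametrization_iff : IsRationalParametrization F φ ψ ↔
    {t : ℂ | ¬ ∃ x y, HasValueAt φ t x ∧ HasValueAt ψ t y ∧
      MvPolynomial.eval ![x, y] F = 0}.Finite ∧
    {p : ℂ × ℂ | MvPolynomial.eval ![p.1, p.2] F = 0 ∧
      ¬ ∃! t, HasValueAt φ t p.1 ∧ HasValueAt ψ t p.2}.Finite := by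
  have on_curve_iff (t : ℂ) : (∃ x y, HasValueAt φ t x ∧ HasValueAt ψ t y ∧
      MvPolynomial.eval ![x, y] F = 0) ↔
      DefinedAt φ t ∧ DefinedAt ψ t ∧ MvPolynomial.eval ![value φ t, value ψ t] F = 0 := by
    simp only [hasValueAt_iff_value]
    grind
  have lies_over_iff (t : ℂ) (p : ℂ × ℂ) : HasValueAt φ t p.1 ∧ HasValueAt ψ t p.2 ↔
      DefinedAt φ t ∧ DefinedAt ψ t ∧ p.1 = value φ t ∧ p.2 = value ψ t := by
    simp only [hasValueAt_iff_value]
    tauto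
  simp only [on_curve_iff, lies_over_iff]
  exact ⟨fun h => ⟨h.on_curve, h.unique_param⟩, fun h => ⟨h.1, h.2⟩⟩

theorem IsBirationalPair.isRationalParametrization (hF : Irreducible F) (hord : 0 < F.degreeOf 1)
    {A B : MvPolynomial (Fin 2) ℂ} (h : IsBirationalPair F A B φ ψ) :
    IsRationalParametrization F φ ψ := by
  refine isRationalParametrization_iff.mpr ⟨?_, ?_⟩
  · refine ((finite_setOf_not_hasValueAt φ).union (finite_setOf_not_hasValueAt ψ)).subset
      fun t ht => ?_
    by_contra hdefined
    simp only [Set.mem_union, Set.mem_ofPred_eq, not_or, not_not] at hdefined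
    obtain ⟨⟨x, hx⟩, y, hy⟩ := hdefined
    have hF0 := HasValueAt.mvAeval (v := ![φ, ψ]) (w := ![x, y])
      (Fin.forall_fin_two.mpr ⟨hx, hy⟩) F
    rw [h.aeval_eq_zero] at hF0
    exact ht ⟨x, y, hx, hy, hF0.eq_zero (ker_algebraMap_le _)⟩
  · refine (finite_setOf_common_zeros hF hord h.not_dvd).subset ?_
    rintro ⟨x, y⟩ ⟨hxy, hunique⟩
    refine ⟨hxy, by_contra fun hB => hunique ⟨_, h.hasValueAt hF hord hxy hB rfl, ?_⟩⟩
    exact fun t ht => h.eq_div_of_hasValueAt ht.1 ht.2 hB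

namespace IsRationalParametrization

theorem aeval_eq_zero (h : IsRationalParametrization F φ ψ) :
    MvPolynomial.aeval ![φ, ψ] F = 0 := by
  have hzeros : {t | HasValueAt (MvPolynomial.aeval ![φ, ψ] F) t 0}.Infinite := by
    refine (isRationalParametrization_iff.mp h).1.infinite_compl.mono fun t ht => ?_
    obtain ⟨x, y, hx, hy, hxy⟩ := not_not.mp ht
    have hF0 := HasValueAt.mvAeval (v := ![φ, ψ]) (w := ![x, y])
      (Fin.forall_fin_two.mpr ⟨hx, hy⟩) F
    rwa [show MvPolynomial.aeval ![x, y] F = 0 from hxy] at hF0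
  obtain ⟨c, hc⟩ := not_not.mp fun hconst => hzeros (finite_setOf_hasValueAt hconst 0)
  obtain ⟨t, ht⟩ := hzeros.nonempty
  rw [hc] at ht
  rw [hc, (HasValueAt.C t c).unique ht, map_zero]

theorem not_const (hord : 0 < F.degreeOf 1) (h : IsRationalParametrization F φ ψ) :
    ¬ ∃ a, φ = RatFunc.C a := by
  classical
  rintro ⟨a, rfl⟩
  set f := (Bivariate.equivMvPolynomial ℂ).symm F
  have hdeg : 0 < f.natDegree := natDegree_equivMvPolynomial_symm_pos hord
  have hlead : f.leadingCoeff ≠ 0 := by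
    rintro h0
    simp [leadingCoeff_eq_zero.mp h0] at hdeg
  obtain ⟨x, hx⟩ := ((f.leadingCoeff.roots.toFinset.finite_toSet.union
    (Set.finite_singleton a)).union
      ((isRationalParametrization_iff.mp h).2.image Prod.fst)).infinite_compl.nonempty
  simp only [Set.mem_compl_iff, Set.mem_union, Set.mem_singleton_iff, not_or] at hx
  obtain ⟨⟨hxlead, hxa⟩, hxcovered⟩ := hx
  have hxlead' : evalRingHom x f.leadingCoeff ≠ 0 := fun h0 => hxlead (by simpa [hlead] using h0)
  obtain ⟨y, hy⟩ := IsAlgClosed.exists_root (f.map (evalRingHom x)) (by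
    rw [degree_map_eq_of_leadingCoeff_ne_zero _ hxlead']
    exact (natDegree_pos_iff_degree_pos.mp hdeg).ne')
  refine hxcovered ⟨(x, y), ⟨?_, ?_⟩, rfl⟩
  · rw [eval_eq_evalEval_equivMvPolynomial_symm, ← map_evalRingHom_eval]
    exact hy
  · rintro ⟨t, ⟨ht, -⟩, -⟩
    exact hxa (ht.unique (HasValueAt.C t a))

theorem exists_finite_injective_of_subst (hord : 0 < F.degreeOf 1) {f g m : RatFunc ℂ}
    (hm : Transcendental ℂ m) (h : IsRationalParametrization F (subst m hm f) (subst m hm g)) :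
    ∃ S : Set ℂ, S.Finite ∧
      ∀ s ∉ S, ∀ t ∉ S, ∀ c, HasValueAt m s c → HasValueAt m t c → s = t := by
  obtain ⟨hcurve, hunique⟩ := isRationalParametrization_iff.mp h
  refine ⟨_, hcurve.union
    (hunique.biUnion fun p _ => finite_setOf_hasValueAt (h.not_const hord) p.1), ?_⟩
  intro s hs t ht c hsc htc
  obtain ⟨hs_curve, hs_good⟩ := not_or.mp hs
  obtain ⟨x, y, hx, hy, hxy⟩ := not_not.mp hs_curve
  obtain ⟨x', y', hx', hy', -⟩ := not_not.mp (not_or.mp ht).1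
  have hxx' : x = x' := (hasValueAt_iff.mpr (hsc.of_subst hm hx)).unique
    (hasValueAt_iff.mpr (htc.of_subst hm hx'))
  have hyy' : y = y' := (hasValueAt_iff.mpr (hsc.of_subst hm hy)).unique
    (hasValueAt_iff.mpr (htc.of_subst hm hy'))
  subst hxx' hyy'
  have hexists : ∃! t, HasValueAt (subst m hm f) t x ∧ HasValueAt (subst m hm g) t y :=
    by_contra fun hcon => hs_good (Set.mem_biUnion (x := (x, y)) ⟨hxy, hcon⟩ hx)
  exact hexists.unique ⟨hx, hy⟩ ⟨hx', hy'⟩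

end IsRationalParametrization

end Parametrizations

/-! ### Injective rational functions -/

section Injective

variable {K : Type*} [Field K] [IsAlgClosed K]

theorem natDegree_le_one_of_simple_root {p : K[X]}
    (hsimple : ∀ t, p.IsRoot t → ¬ (derivative p).IsRoot t)
    (hunique : ∀ s t, p.IsRoot s → p.IsRoot t → s = t) : p.natDegree ≤ 1 := by
  classical
  rcases eq_or_ne p 0 with rfl | hp
  · simp
  have hnodup : p.roots.Nodup := Multiset.nodup_iff_count_le_one.mpr fun t => by
    rw [count_roots]
    by_contra! hmult
    obtain ⟨hroot, hderiv⟩ := (one_lt_rootMultiplicity_iff_isRoot hp).mp hmult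
    exact hsimple t hroot hderiv
  rw [← IsAlgClosed.card_roots_eq_natDegree, ← Multiset.toFinset_card_of_nodup hnodup,
    Finset.card_le_one]
  intro s hs t ht
  rw [Multiset.mem_toFinset, mem_roots hp] at hs ht
  exact hunique s t hs ht

theorem natDegree_num_sub_C_mul_denom_le_one {m : RatFunc K} {c : K}
    (hnoncrit : ∀ t, HasValueAt m t c → ¬ (wronskian m.num m.denom).IsRoot t)
    (hunique : ∀ s t, HasValueAt m s c → HasValueAt m t c → s = t) :
    (m.num - C c * m.denom).natDegree ≤ 1 := by
  simp only [hasValueAt_iff_isRoot] at hnoncrit hunique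
  refine natDegree_le_one_of_simple_root (fun t ht ht' => hnoncrit t ht ?_) hunique
  simp only [IsRoot.def, derivative_sub, derivative_C_mul, eval_sub, eval_mul, eval_C] at ht ht'
  simp only [IsRoot.def, wronskian, eval_sub, eval_mul]
  linear_combination (derivative m.denom).eval t * ht - m.denom.eval t * ht'

theorem natDegree_le_one_of_injective {m : RatFunc K} (hm : ratDeriv m ≠ 0) {S : Set K}
    (hS : S.Finite)
    (hinj : ∀ s ∉ S, ∀ t ∉ S, ∀ c, HasValueAt m s c → HasValueAt m t c → s = t) :
    m.num.natDegree ≤ 1 ∧ m.denom.natDegree ≤ 1 := by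
  classical
  have hwronskian : wronskian m.num m.denom ≠ 0 := fun h => hm (by
    rw [ratDeriv, div_eq_zero_iff]
    left
    rw [show derivative m.num * m.denom - m.num * derivative m.denom = 0 by
      linear_combination (norm := (rw [wronskian]; ring)) -h, map_zero])
  set T := S ∪ (wronskian m.num m.denom).roots.toFinset with hT
  have hbad : (⋃ t ∈ T, {c | HasValueAt m t c}).Finite :=
    (hS.union (Finset.finite_toSet _)).biUnion fun t _ =>
      Set.Subsingleton.finite fun _ hc _ hc' => hc.unique hc'
  have hdegree (c : K) (hc : c ∉ ⋃ t ∈ T, {c | HasValueAt m t c}) :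
      (m.num - C c * m.denom).natDegree ≤ 1 := by
    simp only [Set.mem_iUnion, Set.mem_ofPred_eq, exists_prop, not_exists, not_and, hT,
      Set.mem_union, Finset.mem_coe, Multiset.mem_toFinset, mem_roots hwronskian] at hc
    exact natDegree_num_sub_C_mul_denom_le_one (fun t ht hroot => hc t (.inr hroot) ht)
      fun s t hs ht => hinj s (fun h => hc s (.inl h) hs) t (fun h => hc t (.inl h) ht) c hs ht
  obtain ⟨c, hc, c', hc', hne⟩ := hbad.infinite_compl.nontrivial
  have hdenom : m.denom.natDegree ≤ 1 := by
    have hdenom_eq : m.denom =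
        C (c' - c)⁻¹ * ((m.num - C c * m.denom) - (m.num - C c' * m.denom)) := by
      rw [sub_sub_sub_cancel_left, ← sub_mul, ← C_sub, ← mul_assoc, ← C_mul,
        inv_mul_cancel₀ (sub_ne_zero.mpr hne.symm), C_1, one_mul]
    rw [hdenom_eq]
    exact (natDegree_C_mul_le _ _).trans
      (natDegree_sub_le_of_le (hdegree c hc) (hdegree c' hc'))
  refine ⟨?_, hdenom⟩
  rw [← sub_add_cancel m.num (C c * m.denom)]
  exact natDegree_add_le_of_degree_le (hdegree c hc) ((natDegree_C_mul_le _ _).trans hdenom)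

end Injective

/-! ### Reductions and solutions -/

section Reduction

variable {F : MvPolynomial (Fin 2) ℂ} {φ ψ : RatFunc ℂ}

theorem ratComp_eq_subst {g : RatFunc ℂ} (hg : Transcendental ℂ g) (f : RatFunc ℂ) :
    ratComp f g = subst g hg f :=
  (subst_apply hg f).symm

theorem ratDeriv_C_mul_X_add_C {K : Type*} [Field K] (a b : K) :
    ratDeriv (RatFunc.C a * RatFunc.X + RatFunc.C b) = RatFunc.C a := by
  rw [ratDeriv_add, ratDeriv_mul, ratDeriv_C, ratDeriv_C, ratDeriv_X, mul_one, mul_zero, add_zero,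
    add_zero]

theorem transcendental_C_mul_X_add_C {K : Type*} [Field K] [CharZero K] {a : K} (ha : a ≠ 0)
    (b : K) : Transcendental K (RatFunc.C a * RatFunc.X + RatFunc.C b) :=
  transcendental_of_ratDeriv_ne_zero (by simpa [ratDeriv_C_mul_X_add_C] using ha)

theorem affinelyReduces_iff {R S : RatFunc ℂ} : AffinelyReduces R S ↔
    ∃ (α β : ℂ) (hα : α ≠ 0),
      subst _ (transcendental_C_mul_X_add_C hα β) R = S * RatFunc.C α := by
  refine exists₂_congr fun α β => ?_
  rw [← exists_prop]
  refine exists_congr fun hα => ?_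
  rw [ratComp_eq_subst (transcendental_C_mul_X_add_C hα β), div_eq_iff (by simpa using hα)]

theorem exists_solution_of_affinelyReduces (hF : MvPolynomial.aeval ![φ, ψ] F = 0)
    {S h : RatFunc ℂ} (hS : S ≠ 0) (hred : AffinelyReduces (reducedRHS φ ψ) S)
    (hh : ratDeriv h = ratComp S h) (hh0 : ratDeriv h ≠ 0) :
    ∃ f : RatFunc ℂ, IsNonconstantSolution F f := by
  obtain ⟨α, β, hα, hred⟩ := affinelyReduces_iff.mp hred
  have htr := transcendental_of_ratDeriv_ne_zero (k := ℂ) hh0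
  rw [ratComp_eq_subst htr] at hh
  set g := RatFunc.C α * RatFunc.X + RatFunc.C β
  have hgtr : Transcendental ℂ g := transcendental_C_mul_X_add_C hα β
  have hg : ratDeriv g = RatFunc.C α := ratDeriv_C_mul_X_add_C α β
  have hφ : ratDeriv φ ≠ 0 := by
    rintro hφ
    rw [reducedRHS, hφ, div_zero, map_zero] at hred
    exact mul_ne_zero hS (by simpa using hα) hred.symm
  have hψ : subst g hgtr ψ = S * ratDeriv (subst g hgtr φ) := by
    rw [reducedRHS, map_div₀, div_eq_iff (by simpa using hφ)] at hred
    rw [hred, ratDeriv_subst, hg]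
    ring
  have hderiv : ratDeriv (subst h htr (subst g hgtr φ)) = subst h htr (subst g hgtr ψ) := by
    rw [ratDeriv_subst, hψ, map_mul, hh, mul_comm]
  refine ⟨subst h htr (subst g hgtr φ), ?_, ?_⟩
  · rw [hderiv, aeval_pair_algHom, aeval_pair_algHom, hF, map_zero, map_zero]
  · rw [ratDeriv_subst, ratDeriv_subst, hg]
    simp [hφ, hα, hh0]

theorem exists_solution_of_reduces (hF : MvPolynomial.aeval ![φ, ψ] F = 0)
    (hred : ReducesToLinear φ ψ ∨ ReducesToRiccati φ ψ) :
    ∃ f : RatFunc ℂ, IsNonconstantSolution F f := by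
  rcases hred with ⟨c, hc, hred⟩ | hred
  · have hderiv : ratDeriv (RatFunc.C c * RatFunc.X) = RatFunc.C c := by
      simpa using ratDeriv_C_mul_X_add_C c 0
    have hc' : (RatFunc.C c : RatFunc ℂ) ≠ 0 := by simpa using hc
    refine exists_solution_of_affinelyReduces hF hc' hred (h := RatFunc.C c * RatFunc.X) ?_ ?_
    · simp [hderiv, ratComp]
    · rwa [hderiv]
  · have hX : (RatFunc.X : RatFunc ℂ) ≠ 0 := RatFunc.X_ne_zero
    have hderiv : ratDeriv (RatFunc.X⁻¹ : RatFunc ℂ) ≠ 0 := by simp [ratDeriv_inv_X, hX]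
    refine exists_solution_of_affinelyReduces hF (by simp [hX]) hred (h := RatFunc.X⁻¹) ?_ hderiv
    rw [ratComp_eq_subst (transcendental_of_ratDeriv_ne_zero (k := ℂ) hderiv), map_neg, map_pow,
      subst_X, ratDeriv_inv_X]

theorem affinelyReduces_inv_ratDeriv {m : RatFunc ℂ} (hm : ratDeriv m ≠ 0)
    (hnum : m.num.natDegree ≤ 1) (hdenom : m.denom.natDegree ≤ 1) :
    (∃ c ≠ 0, AffinelyReduces (ratDeriv m)⁻¹ (RatFunc.C c)) ∨
      AffinelyReduces (ratDeriv m)⁻¹ (-RatFunc.X ^ 2) := by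
  obtain ⟨a, b, hP⟩ := exists_eq_X_add_C_of_natDegree_le_one hnum
  obtain ⟨c, d, hQ⟩ := exists_eq_X_add_C_of_natDegree_le_one hdenom
  set w := a * d - b * c with hw
  have hderiv : (ratDeriv m)⁻¹ =
      (RatFunc.C c * RatFunc.X + RatFunc.C d) ^ 2 / RatFunc.C w := by
    rw [ratDeriv, inv_div, hP, hQ, hw]
    simp
    ring_nf
  have hw0 : w ≠ 0 := by
    rintro hw0
    rw [hw0, map_zero, div_zero, inv_eq_zero] at hderiv
    exact hm hderiv
  have hCw : RatFunc.C w ≠ 0 := by simpa using hw0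
  rcases eq_or_ne c 0 with rfl | hc
  · have hd : d ≠ 0 := by
      rintro rfl
      exact m.denom_ne_zero (by rw [hQ]; simp)
    refine .inl ⟨d ^ 2 / w, div_ne_zero (pow_ne_zero 2 hd) hw0, affinelyReduces_iff.mpr
      ⟨1, 0, one_ne_zero, ?_⟩⟩
    simp [hderiv, subst_C]
  · refine .inr (affinelyReduces_iff.mpr ⟨-w / c ^ 2, -d / c,
      div_ne_zero (neg_ne_zero.mpr hw0) (pow_ne_zero 2 hc), ?_⟩)
    have hCc : RatFunc.C c ≠ 0 := by simpa using hc
    simp only [hderiv, map_div₀, map_pow, map_add, map_mul, subst_C, subst_X, map_neg,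
      RatFunc.algebraMap_eq_C]
    field_simp
    ring

theorem reduces_of_solution (hF : Irreducible F) (hord : 0 < F.degreeOf 1)
    (h : IsRationalParametrization F φ ψ) {f : RatFunc ℂ} (hf : IsNonconstantSolution F f) :
    ReducesToLinear φ ψ ∨ ReducesToRiccati φ ψ := by
  obtain ⟨A, B, hbir⟩ := hf.exists_isBirationalPair hF hord
  have hφ : ¬ ∃ a, φ = RatFunc.C a := h.not_const hord
  obtain ⟨m, hm, rfl, rfl⟩ := hbir.exists_subst_eq hF hord
    (RatFunc.transcendental_of_ne_C φ hφ) h.aeval_eq_zero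
  have hderiv : ratDeriv m ≠ 0 := fun h0 =>
    hφ (ratDeriv_eq_zero_iff.mp (by rw [ratDeriv_subst, h0, mul_zero]))
  have hRHS : reducedRHS (subst m hm f) (subst m hm (ratDeriv f)) = (ratDeriv m)⁻¹ := by
    rw [reducedRHS, ratDeriv_subst, div_mul_cancel_left₀ (by simpa using hf.ratDeriv_ne_zero)]
  obtain ⟨S, hS, hinj⟩ := h.exists_finite_injective_of_subst hord hm
  obtain ⟨hnum, hdenom⟩ := natDegree_le_one_of_injective hderiv hS hinj
  rw [ReducesToLinear, ReducesToRiccati, hRHS]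
  exact affinelyReduces_inv_ratDeriv hderiv hnum hdenom

theorem reducesToLinear_ratDeriv {f : RatFunc ℂ} (hf : ratDeriv f ≠ 0) :
    ReducesToLinear f (ratDeriv f) := by
  refine ⟨1, one_ne_zero, 1, 0, one_ne_zero, ?_⟩
  rw [reducedRHS, div_self hf]
  simp [ratComp]

end Reduction

end FirstOrderADE

end

theorem mainTheorem3 (F : MvPolynomial (Fin 2) ℂ) (hF : Irreducible F)
    (hord : 0 < F.degreeOf 1) :
    -- reduction along some rational parametrization
    (FirstOrderADE.HasNonconstantRationalGeneralSolution F ↔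
      ∃ φ ψ : RatFunc ℂ, FirstOrderADE.IsRationalParametrization F φ ψ ∧
        (FirstOrderADE.ReducesToLinear φ ψ ∨ FirstOrderADE.ReducesToRiccati φ ψ)) ∧
    -- reduction along any given rational parametrization
    (∀ φ ψ : RatFunc ℂ, FirstOrderADE.IsRationalParametrization F φ ψ →
      (FirstOrderADE.HasNonconstantRationalGeneralSolution F ↔
        (FirstOrderADE.ReducesToLinear φ ψ ∨ FirstOrderADE.ReducesToRiccati φ ψ))) ∧
    -- the general solution `1 / (z + λ)` of `u' + u ^ 2 = 0`
    FirstOrderADE.IsRationalGeneralSolution (MvPolynomial.X 1 + MvPolynomial.X 0 ^ 2)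
      (1 / (FirstOrderADE.zVar + FirstOrderADE.lamVar)) := by
  open FirstOrderADE in
  rw [hasNonconstantRationalGeneralSolution_iff]
  refine ⟨⟨?_, ?_⟩, fun φ ψ hpar => ⟨?_, ?_⟩, isRationalGeneralSolution_riccati⟩
  · rintro ⟨f, hf⟩
    obtain ⟨A, B, hbir⟩ := hf.exists_isBirationalPair hF hord
    exact ⟨f, ratDeriv f, hbir.isRationalParametrization hF hord,
      .inl (reducesToLinear_ratDeriv hf.ratDeriv_ne_zero)⟩
  · rintro ⟨φ, ψ, hpar, hred⟩
    exact exists_solution_of_reduces hpar.aeval_eq_zero hred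
  · rintro ⟨f, hf⟩
    exact reduces_of_solution hF hord hpar hf
  · exact exists_solution_of_reduces hpar.aeval_eq_zero
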